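/- Let $S^1=\mathbb R/2\pi\mathbb Z$, let $\mathbb E^2$ be the Euclidean plane, and let $$\hat{\mathcal M}=\{\hat\gamma:S^1\to\mathbb E^2 \text{ smooth}\mid \langle\hat\gamma_s,\hat\gamma_s\rangle\equiv 1\}$$ be the space of closed unit-speed plane curves. For $\hat\gamma\in\hat{\mathcal M}$ let $T=\hat\gamma_s$, let $N$ be the left-oriented unit normal, and let $\hat\kappa$ be the curvature, $T_s=\hat\kappa N$. A motion is a one-parameter family $t\mapsto\hat\gamma(\cdot,t)\in\hat{\mathcal M}$, $t\in\mathbb R$, that is smooth in $(s,t)$. The tangent space is $$T_{\hat\gamma}\hat{\mathcal M}=\{\lambda T+\mu N\mid \lambda,\mu:S^1\to\mathbb R\text{ smooth},\ \lambda_s=\hat\kappa\mu\},$$ and the differential of a function $F$ on $\hat{\mathcal M}$ is given by $dF(Y)=\frac{d}{dt}\big|_{t=0}F(\hat\gamma(\cdot,t))$ for any motion with $\hat\gamma(\cdot,0)=\hat\gamma$ and $\hat\gamma_t(\cdot,0)=Y$. Define $$\hat\omega_1(X,Y)=\frac12\int_{S^1}\langle D_sX,D_s^2Y\rangle\,ds,\qquad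 D_s=\frac{\partial}{\partial s},\quad X,Y\in T_{\hat\gamma}\hat{\mathcal M},$$ and $\hat H_1(\hat\gamma)=\int_{S^1}\frac14\hat\kappa^2\,ds$. Let $S^1$ act on $\hat{\mathcal M}$ by $\sigma\cdot\hat\gamma=\hat\gamma(\cdot+\sigma)$, and for $A\in\mathrm{Lie}(S^1)=\mathbb R\,\frac{\partial}{\partial\sigma}$ let $\underline A$ be the fundamental vector field, so that $\underline{A}_{\hat\gamma}=a\hat\gamma_s$ for $A=a\frac{\partial}{\partial\sigma}$. **Theorem.** 1. For each $\hat\gamma\in\hat{\mathcal M}$, $T_{\hat\gamma}\hat{\mathcal M}$ is exactly the set of the velocities $\hat\gamma_t(\cdot,0)$ of motions with $\hat\gamma(\cdot,0)=\hat\gamma$. 2. For $X=\lambda T+\mu N$ and $Y=\tilde\lambda T+\tilde\mu N$ in $T_{\hat\gamma}\hat{\mathcal M}$, $$\hat\omega_1(X,Y)=\int_{S^1}(\hat\kappa\lambda+\mu_s)\,\hat\Omega\tilde\mu\,ds,\qquad \hat\Omega\tilde\mu=\tfrac12\big(\tilde\mu_{ss}+\hat\kappa^2\tilde\mu+\hat\kappa_s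 D_s^{-1}(\hat\kappa\tilde\mu)\big),$$ where $D_s^{-1}(\hat\kappa\tilde\mu)$ is taken to be the primitive $\tilde\lambda$. 3. The $S^1$-action preserves $\hat\omega_1$: for $X,Y\in T_{\hat\gamma}\hat{\mathcal M}$ and $\sigma\in S^1$, the translates $X(\cdot+\sigma)$, $Y(\cdot+\sigma)$ lie in $T_{\sigma\cdot\hat\gamma}\hat{\mathcal M}$, and $\hat\omega_1(X(\cdot+\sigma),Y(\cdot+\sigma))=\hat\omega_1(X,Y)$. 4. The fundamental vector fields are tangent to $\hat{\mathcal M}$, and the $S^1$-action has a moment map $\hat\mu_1:\hat{\mathcal M}\to\mathrm{Lie}(S^1)^*$ with respect to $\hat\omega_1$ that is given by $$\hat\mu_1(\hat\gamma)\Big(\frac{\partial}{\partial\sigma}\Big)=\hat H_1(\hat\gamma),\qquad\hat\gamma\in\hat{\mathcal M}.$$ That is, $\hat\mu_1$ is $S^1$-invariant, and $d\big(\hat\mu_1(\cdot)(A)\big)=\hat\omega_1(\underline A,\,\cdot\,)$ on $T_{\hat\gamma}\hat{\mathcal M}$ for all $A\in\mathrm{Lie}(S^1)$ and $\hat\gamma\in\hat{\mathcal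 M}$. -/

import Mathlib

open scoped ContDiff RealInnerProductSpace
open MeasureTheory

namespace PlaneCurves

noncomputable section

/-- The circle `S¹ = ℝ / 2πℤ`, with its quotient measure of total mass `2π`. -/
abbrev S1 : Type := AddCircle (2 * Real.pi)

/-- The total length `2π` of the circle is positive. -/
instance factTwoPiPos : Fact (0 < 2 * Real.pi) := ⟨Real.two_pi_pos⟩

/-- The Euclidean plane. -/
abbrev E2 : Type := EuclideanSpace ℝ (Fin 2)

/-- Smoothness of a map on the circle, i.e. of its `2π`-periodic lift to `ℝ`. -/
def Smooth {V : Type} [NormedAddCommGroup V] [NormedSpace ℝ V] (f : S1 → V) : Prop :=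
  ContDiff ℝ ∞ (fun t : ℝ => f (t : S1))

/-- The derivative `D_s = ∂/∂s` of a map on the circle. -/
def Ds {V : Type} [NormedAddCommGroup V] [NormedSpace ℝ V] (f : S1 → V) : S1 → V :=
  fun s => deriv (fun h : ℝ => f (s + (h : S1))) 0

/-- The translate `f(· + σ)` of a map on the circle. -/
def shift {V : Type} (σ : S1) (f : S1 → V) : S1 → V := fun s => f (s + σ)

/-- The space of smooth closed plane curves `S¹ → 𝔼²` of unit speed. -/
def MHat : Set (S1 → E2) := {γ | Smooth γ ∧ ∀ s, ⟪Ds γ s, Ds γ s⟫ = 1}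

theorem Ds_shift {V : Type} [NormedAddCommGroup V] [NormedSpace ℝ V] (σ : S1) (f : S1 → V) :
    Ds (shift σ f) = shift σ (Ds f) := by
  funext s
  simp only [Ds, shift, add_right_comm]

theorem Smooth.shift {V : Type} [NormedAddCommGroup V] [NormedSpace ℝ V] {f : S1 → V}
    (hf : Smooth f) (σ : S1) : Smooth (shift σ f) := by
  induction σ using QuotientAddGroup.induction_on with
  | H c =>
    have h : ContDiff ℝ ∞ (fun t : ℝ => t + c) := contDiff_id.add contDiff_const
    exact ContDiff.comp (g := fun t : ℝ => f (t : S1)) hf h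

theorem shift_mem_MHat (σ : S1) {γ : S1 → E2} (hγ : γ ∈ MHat) : shift σ γ ∈ MHat :=
  ⟨hγ.1.shift σ, fun s => by rw [Ds_shift]; exact hγ.2 (s + σ)⟩

/-- The action of `S¹` on the space of closed unit-speed curves, `σ · γ = γ(· + σ)`. -/
instance curveAction : AddAction S1 MHat where
  vadd σ γ := ⟨shift σ γ.1, shift_mem_MHat σ γ.2⟩
  zero_vadd γ := Subtype.ext (funext fun s => congrArg γ.1 (add_zero s))
  add_vadd σ τ γ := Subtype.ext (funext fun s => congrArg γ.1 (add_assoc s σ τ).symm)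

/-- The rotation by `+π/2`. -/
def rot (v : E2) : E2 := !₂[-v 1, v 0]

/-- The unit tangent `T = γ_s`. -/
def tangent (γ : MHat) : S1 → E2 := Ds γ.1

/-- The left-oriented unit normal `N`. -/
def normal (γ : MHat) : S1 → E2 := fun s => rot (tangent γ s)

/-- The curvature. Since `T` has unit length, `T_s` is a multiple of the unit vector `N`, so this
is the function `κ` with `T_s = κ N`. -/
def curvature (γ : MHat) : S1 → ℝ := fun s => ⟪Ds (tangent γ) s, normal γ s⟫

/-- The vector field `λ T + μ N` along `γ`. -/
def frameField (γ : MHat) (lam mu : S1 → ℝ) : S1 → E2 :=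
  fun s => lam s • tangent γ s + mu s • normal γ s

/-- `(λ, μ)` are the frame components of a tangent vector at `γ`: smooth, with `λ_s = κ μ`. -/
def IsTangentPair (γ : MHat) (lam mu : S1 → ℝ) : Prop :=
  Smooth lam ∧ Smooth mu ∧ ∀ s, Ds lam s = curvature γ s * mu s

/-- The tangent space at `γ`: all fields `λ T + μ N` with `λ, μ` smooth and `λ_s = κ μ`. -/
def tangentSpace (γ : MHat) : Set (S1 → E2) :=
  {X | ∃ lam mu : S1 → ℝ, IsTangentPair γ lam mu ∧ X = frameField γ lam mu}

/-- A smooth one-parameter family of closed unit-speed curves (smooth jointly in `t` and `s`). -/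
def IsMotion (Γ : ℝ → MHat) : Prop :=
  ContDiff ℝ ∞ (fun p : ℝ × ℝ => (Γ p.1).1 (p.2 : S1))

/-- The motion vector field `γ_t` at `t = 0`. -/
def initialVelocity (Γ : ℝ → MHat) : S1 → E2 := fun s => deriv (fun t : ℝ => (Γ t).1 s) 0

/-- The differential of `γ ↦ σ · γ` sends a tangent vector `Y` to its translate `Y(· + σ)`. -/
theorem initialVelocity_vadd (σ : S1) (Γ : ℝ → MHat) :
    initialVelocity (fun t => σ +ᵥ Γ t) = shift σ (initialVelocity Γ) := rfl

/-- `dF_γ = ℓ` on the tangent space at `γ`: the derivative of `F` along any smooth motion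
starting at `γ` with velocity `Y` exists and equals `ℓ Y`. -/
def HasDifferentialAt (F : MHat → ℝ) (γ : MHat) (ℓ : (S1 → E2) → ℝ) : Prop :=
  ∀ Y ∈ tangentSpace γ, ∀ Γ : ℝ → MHat, IsMotion Γ → Γ 0 = γ → initialVelocity Γ = Y →
    HasDerivAt (fun t => F (Γ t)) (ℓ Y) 0

/-- The form `ω̂₁(X, Y) = ½ ∫ ⟨D_s X, D_s² Y⟩ ds`. -/
def omegaHat1 (X Y : S1 → E2) : ℝ := (1 / 2) * ∫ s : S1, ⟪Ds X s, Ds (Ds Y) s⟫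

/-- The recursion operator `Ω̂ μ = ½ (μ_ss + κ² μ + κ_s D_s⁻¹(κ μ))` of the mKdV equation, where
`D_s⁻¹(κ μ)` is the given primitive `lam` of `κ μ`. -/
def OmegaHat (γ : MHat) (lam mu : S1 → ℝ) : S1 → ℝ := fun s =>
  (1 / 2) * (Ds (Ds mu) s + curvature γ s ^ 2 * mu s + Ds (curvature γ) s * lam s)

/-- The functional `Ĥ₁ = ∫ ¼ κ² ds`. -/
def HHat1 (γ : MHat) : ℝ := ∫ s : S1, (1 / 4) * curvature γ s ^ 2

/-- The fundamental vector field of `a · ∂/∂σ ∈ Lie(S¹)`, where `Lie(S¹)` is identified with `ℝ`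
by `∂/∂σ ↦ 1` (so that the exponential map is the projection `ℝ → S¹`). -/
def fundamentalField (a : ℝ) (γ : MHat) : S1 → E2 := fun s =>
  deriv (fun τ : ℝ => (((τ * a : ℝ) : S1) +ᵥ γ).1 s) 0

/-- `μ : MHat → Lie(S¹)*` is a moment map for the `S¹`-action with respect to the two-form `form`:
`d⟨μ, A⟩ = form(A̲, ·)` for each `A ∈ Lie(S¹)`, and `μ` is equivariant, which means invariant since
`S¹` is commutative. -/
structure IsMomentMap (form : (S1 → E2) → (S1 → E2) → ℝ) (μ : MHat → Module.Dual ℝ ℝ) : Prop where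
  differential : ∀ (a : ℝ) (γ : MHat),
    HasDifferentialAt (fun δ => μ δ a) γ (fun Y => form (fundamentalField a γ) Y)
  equivariant : ∀ (σ : S1) (γ : MHat), μ (σ +ᵥ γ) = μ γ

end

end PlaneCurves

/-! Differentiating `⟨γ_s, γ_s⟩ = 1` in time gives `⟨D_s Y, T⟩ = 0` for the velocity `Y = λT + μN`
of a motion, and this is `λ_s = κμ`. So tangency means `D_s Y = φN` with `φ = κλ + μ_s`.

Conversely, given such a `Y`, turn the tangent of `γ` by the angle `τφ + ⟨w, N⟩` and integrate. The
curve closes up when `closingDefect` vanishes. The derivative of the defect in `w` at the origin is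
`w ↦ ∫ ⟨w, N⟩ N`, which is injective because the normals of a closed curve are not all orthogonal to
one nonzero vector. The implicit function theorem yields `w(τ)`, with `w'(0) = 0` since `∫ φN = ∫
D_s Y = 0`; hence the correction does not change the velocity (`exists_closing_parameters`,
`exists_motion_of_tangents`).

The formula for the form follows from `D_s X = φN` and `φ_s = 2 Ω̂μ`. Invariance is translation
invariance of the measure. For the moment map, `κ² = |γ_ss|²`, so the derivative of `Ĥ₁` along `Y`
is `½ ∫ ⟨γ_ss, Y_ss⟩ = ω̂₁(γ_s, Y)`, with no integration by parts (`IsMotion.hasDerivAt_HHat1`). -/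

namespace PlaneCurves

noncomputable section

/-! ### Partial derivatives, parametric integrals, implicit functions -/

section Calculus

open Topology Filter

variable {V : Type} [NormedAddCommGroup V] [NormedSpace ℝ V]

/-- The partial derivative in the first variable. -/
def partialFst (G : ℝ × ℝ → V) : ℝ × ℝ → V := fun p => fderiv ℝ G p (1, 0)

/-- The partial derivative in the second variable. -/
def partialSnd (G : ℝ × ℝ → V) : ℝ × ℝ → V := fun p => fderiv ℝ G p (0, 1)

theorem contDiff_partialFst {G : ℝ × ℝ → V} (hG : ContDiff ℝ ∞ G) :
    ContDiff ℝ ∞ (partialFst G) :=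
  (hG.fderiv_right (by simp)).clm_apply contDiff_const

theorem contDiff_partialSnd {G : ℝ × ℝ → V} (hG : ContDiff ℝ ∞ G) :
    ContDiff ℝ ∞ (partialSnd G) :=
  (hG.fderiv_right (by simp)).clm_apply contDiff_const

theorem hasDerivAt_partialFst {G : ℝ × ℝ → V} (hG : ContDiff ℝ ∞ G) (t s : ℝ) :
    HasDerivAt (fun t => G (t, s)) (partialFst G (t, s)) t :=
  ((hG.differentiable (by simp)).differentiableAt.hasFDerivAt (x := (t, s))).comp_hasDerivAt t
    ((hasDerivAt_id t).prodMk (hasDerivAt_const t s))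

theorem hasDerivAt_partialSnd {G : ℝ × ℝ → V} (hG : ContDiff ℝ ∞ G) (t s : ℝ) :
    HasDerivAt (fun s => G (t, s)) (partialSnd G (t, s)) s :=
  ((hG.differentiable (by simp)).differentiableAt.hasFDerivAt (x := (t, s))).comp_hasDerivAt s
    ((hasDerivAt_const s t).prodMk (hasDerivAt_id s))

theorem partialFst_partialSnd {G : ℝ × ℝ → V} (hG : ContDiff ℝ ∞ G) :
    partialFst (partialSnd G) = partialSnd (partialFst G) := by
  funext p
  have hd : DifferentiableAt ℝ (fderiv ℝ G) p :=
    ((hG.fderiv_right (m := ∞) (by simp)).differentiable (by simp)).differentiableAt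
  have hsymm : IsSymmSndFDerivAt ℝ G p :=
    hG.contDiffAt.isSymmSndFDerivAt (by
      simpa using (WithTop.coe_le_coe.2 le_top : ((2 : ℕ∞) : WithTop ℕ∞) ≤ ∞))
  have h : ∀ v w : ℝ × ℝ, fderiv ℝ (fun q => fderiv ℝ G q v) p w = fderiv ℝ (fderiv ℝ G) p w v := by
    intro v w
    rw [fderiv_clm_apply hd (differentiableAt_const v)]
    simp
  simp only [partialFst, partialSnd] at *
  change fderiv ℝ (fun q => fderiv ℝ G q (0, 1)) p (1, 0)
    = fderiv ℝ (fun q => fderiv ℝ G q (1, 0)) p (0, 1)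
  rw [h, h, hsymm]

/-- Differentiation under the integral sign of a `C¹` function over a compact interval. -/
theorem hasFDerivAt_intervalIntegral_param {E F : Type} [NormedAddCommGroup E] [NormedSpace ℝ E]
    [FiniteDimensional ℝ E] [NormedAddCommGroup F] [NormedSpace ℝ F] {f : E × ℝ → F}
    (hf : ContDiff ℝ 1 f) (a b : ℝ) (p : E) :
    HasFDerivAt (fun p => ∫ x in a..b, f (p, x))
      (∫ x in a..b, (fderiv ℝ f (p, x)).comp (.inl ℝ E ℝ)) p := by
  have : ProperSpace E := FiniteDimensional.proper ℝ E
  have hc : Continuous fun q : E × ℝ => (fderiv ℝ f q).comp (.inl ℝ E ℝ) :=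
    (hf.continuous_fderiv (by simp)).clm_comp continuous_const
  obtain ⟨C, hC⟩ := ((isCompact_closedBall p 1).prod (isCompact_uIcc (a := a) (b := b))
    ).exists_bound_of_continuousOn hc.continuousOn
  refine intervalIntegral.hasFDerivAt_integral_of_dominated_of_fderiv_le (bound := fun _ => C)
    (F' := fun p x => (fderiv ℝ f (p, x)).comp (.inl ℝ E ℝ)) (Metric.ball_mem_nhds p one_pos)
    ?_ ?_ ?_ ?_ ?_ ?_
  · exact .of_forall fun q =>
      (hf.continuous.comp (by fun_prop : Continuous fun x => (q, x))).aestronglyMeasurable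
  · exact (hf.continuous.comp (by fun_prop : Continuous fun x => (p, x))).intervalIntegrable _ _
  · exact (hc.comp (by fun_prop : Continuous fun x => (p, x))).aestronglyMeasurable
  · exact .of_forall fun x hx q hq =>
      hC (q, x) ⟨Metric.ball_subset_closedBall hq, Set.uIoc_subset_uIcc hx⟩
  · exact intervalIntegrable_const
  · exact .of_forall fun x _ q _ =>
      ((hf.differentiable (by simp)).differentiableAt.hasFDerivAt (x := (q, x))).comp q
        (hasFDerivAt_prodMk_left q x)

theorem contDiff_intervalIntegral_param {E : Type} [NormedAddCommGroup E] [NormedSpace ℝ E]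
    [FiniteDimensional ℝ E] {f : E × ℝ → V} (hf : ContDiff ℝ ∞ f) (a b : ℝ) :
    ContDiff ℝ ∞ (fun p => ∫ x in a..b, f (p, x)) := by
  -- The target space varies in the induction because the derivative of the integrand takes values
  -- in `E →L[ℝ] F`.
  suffices H : ∀ (n : ℕ) (F : Type) [NormedAddCommGroup F] [NormedSpace ℝ F] (f : E × ℝ → F),
      ContDiff ℝ ∞ f → ContDiff ℝ n (fun p => ∫ x in a..b, f (p, x)) from
    contDiff_infty.2 fun n => H n V f hf
  intro n
  induction n with
  | zero =>
    intro F _ _ f hf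
    exact contDiff_zero.2 (continuous_iff_continuousAt.2 fun p =>
      (hasFDerivAt_intervalIntegral_param (hf.of_le (by simp)) a b p).continuousAt)
  | succ n ih =>
    intro F _ _ f hf
    refine contDiff_succ_iff_hasFDerivAt.2 ⟨_, ?_,
      hasFDerivAt_intervalIntegral_param (hf.of_le (by simp)) a b⟩
    exact ih _ _ ((hf.fderiv_right (by simp)).clm_comp contDiff_const)

theorem hasDerivAt_intervalIntegral_param {f : ℝ × ℝ → V} (hf : ContDiff ℝ ∞ f) (a b t : ℝ) :
    HasDerivAt (fun t => ∫ s in a..b, f (t, s)) (∫ s in a..b, partialFst f (t, s)) t := by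
  have h := (hasFDerivAt_intervalIntegral_param (hf.of_le (by simp)) a b t).hasDerivAt
  have hc : Continuous fun s => (fderiv ℝ f (t, s)).comp (.inl ℝ ℝ ℝ) :=
    ((hf.continuous_fderiv (by simp)).clm_comp continuous_const).comp
      (by fun_prop : Continuous fun s => (t, s))
  rw [ContinuousLinearMap.intervalIntegral_apply (hc.intervalIntegrable _ _)] at h
  exact h

/-- The implicit function theorem, with a function which is smooth on a neighbourhood. -/
theorem exists_smooth_implicitFunction {E₁ E₂ F : Type}
    [NormedAddCommGroup E₁] [NormedSpace ℝ E₁] [CompleteSpace E₁]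
    [NormedAddCommGroup E₂] [NormedSpace ℝ E₂] [CompleteSpace E₂]
    [NormedAddCommGroup F] [NormedSpace ℝ F] [CompleteSpace F]
    {f : E₁ × E₂ → F} (hf : ContDiff ℝ ∞ f) (u : E₁ × E₂)
    (hu : (fderiv ℝ f u ∘L .inr ℝ E₁ E₂).IsInvertible) :
    ∃ ψ : E₁ → E₂, ψ u.1 = u.2 ∧
      HasFDerivAt ψ (-(fderiv ℝ f u ∘L .inr ℝ E₁ E₂).inverse ∘L (fderiv ℝ f u ∘L .inl ℝ E₁ E₂))
        u.1 ∧
      ∀ᶠ x in 𝓝 u.1, f (x, ψ x) = f u ∧ ContDiffAt ℝ ∞ ψ x := by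
  have n0 : (∞ : WithTop ℕ∞) ≠ 0 := by simp
  have hfu : ContDiffAt ℝ ∞ f u := hf.contDiffAt
  set ψ := hfu.implicitFunction n0 hu with hψ
  have hψu : ψ u.1 = u.2 := hfu.implicitFunction_apply_self n0 hu
  have hψs : ContDiffAt ℝ ∞ ψ u.1 := hfu.contDiffAt_implicitFunction n0 hu
  refine ⟨ψ, hψu, (hfu.hasStrictFDerivAt_implicitFunction n0 hu).hasFDerivAt, ?_⟩
  have hsol : ∀ᶠ x in 𝓝 u.1, f (x, ψ x) = f u := hfu.eventually_apply_implicitFunction n0 hu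
  have hcont : ∀ᶠ x in 𝓝 u.1, ContinuousAt ψ x :=
    ((hψs.of_le (m := 1) (by simp)).eventually (by simp)).mono fun x hx => hx.continuousAt
  have hinv : ∀ᶠ x in 𝓝 u.1, (fderiv ℝ f (x, ψ x) ∘L .inr ℝ E₁ E₂).IsInvertible := by
    obtain ⟨e, he⟩ := hu
    have hc : ContinuousAt (fun x => fderiv ℝ f (x, ψ x) ∘L .inr ℝ E₁ E₂) u.1 := by
      have h1 : ContinuousAt (fun x => (x, ψ x)) u.1 := continuousAt_id.prodMk hψs.continuousAt
      have h2 : Continuous fun q => fderiv ℝ f q ∘L .inr ℝ E₁ E₂ :=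
        (hf.continuous_fderiv (by simp)).clm_comp continuous_const
      exact ContinuousAt.comp (g := fun q => fderiv ℝ f q ∘L .inr ℝ E₁ E₂) h2.continuousAt h1
    have hn := ContinuousLinearEquiv.nhds e
    have hv : fderiv ℝ f (u.1, ψ u.1) ∘L .inr ℝ E₁ E₂ = e := by rw [hψu, he]
    exact hc.eventually_mem (s := Set.range ((↑) : (E₂ ≃L[ℝ] F) → E₂ →L[ℝ] F)) (hv.symm ▸ hn)
  filter_upwards [hsol.eventually_nhds, hcont, hinv] with x hx hxc hxi
  refine ⟨hx.self_of_nhds, ?_⟩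
  have hfx : ContDiffAt ℝ ∞ f (x, ψ x) := hf.contDiffAt
  -- `ContDiffAt ℝ ∞` at `u.1` gives a neighbourhood only for each finite order. The theorem is
  -- therefore applied again at `(x, ψ x)`, and local uniqueness identifies the new implicit
  -- function with `ψ`.
  refine (hfx.contDiffAt_implicitFunction n0 hxi).congr_of_eventuallyEq ?_
  have ht : Tendsto (fun y => (y, ψ y)) (𝓝 x) (𝓝 (x, ψ x)) := continuousAt_id.prodMk hxc
  filter_upwards [ht.eventually (hfx.eventually_apply_eq_iff_implicitFunction n0 hxi), hx]
    with y hy hy'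
  exact (hy.1 (hy'.trans hx.self_of_nhds.symm)).symm

end Calculus

/-! ### Calculus on the circle through periodic lifts -/

section Circle

variable {V : Type} [NormedAddCommGroup V] [NormedSpace ℝ V]

theorem Ds_coe (f : S1 → V) (t : ℝ) : Ds f (t : S1) = deriv (fun x : ℝ => f (x : S1)) t := by
  have h := deriv_comp_const_add (f := fun x : ℝ => f (x : S1)) t 0
  simpa only [Ds, AddCircle.coe_add, add_zero] using h

theorem Smooth.hasDerivAt {f : S1 → V} (hf : Smooth f) (t : ℝ) :
    HasDerivAt (fun x : ℝ => f (x : S1)) (Ds f (t : S1)) t := by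
  rw [Ds_coe]
  exact (ContDiff.differentiable hf (by simp)).differentiableAt.hasDerivAt

theorem Ds_eq_of_hasDerivAt {f : S1 → V} {v : V} {t : ℝ}
    (h : HasDerivAt (fun x : ℝ => f (x : S1)) v t) : Ds f (t : S1) = v :=
  (Ds_coe f t).trans h.deriv

theorem Smooth.ds {f : S1 → V} (hf : Smooth f) : Smooth (Ds f) := by
  have h : (fun t : ℝ => Ds f (t : S1)) = deriv (fun t : ℝ => f (t : S1)) := funext (Ds_coe f)
  unfold Smooth
  rw [h]
  exact (contDiff_infty_iff_deriv.1 hf).2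

theorem smooth_const (c : V) : Smooth (fun _ => c) := contDiff_const

theorem Smooth.add {f g : S1 → V} (hf : Smooth f) (hg : Smooth g) :
    Smooth (fun s => f s + g s) := ContDiff.add hf hg

theorem Smooth.mul {f g : S1 → ℝ} (hf : Smooth f) (hg : Smooth g) :
    Smooth (fun s => f s * g s) := ContDiff.mul hf hg

theorem Smooth.smul {f : S1 → ℝ} {g : S1 → V} (hf : Smooth f) (hg : Smooth g) :
    Smooth (fun s => f s • g s) := ContDiff.smul hf hg

theorem Smooth.inner {f g : S1 → E2} (hf : Smooth f) (hg : Smooth g) :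
    Smooth (fun s => ⟪f s, g s⟫) := ContDiff.inner ℝ hf hg

theorem Ds_const (c : V) (s : S1) : Ds (fun _ : S1 => c) s = 0 := by simp [Ds]

theorem Ds_add {f g : S1 → ℝ} (hf : Smooth f) (hg : Smooth g) (s : S1) :
    Ds (fun s => f s + g s) s = Ds f s + Ds g s := by
  induction s using QuotientAddGroup.induction_on with
  | H t => exact Ds_eq_of_hasDerivAt ((hf.hasDerivAt t).add (hg.hasDerivAt t))

theorem Ds_mul {f g : S1 → ℝ} (hf : Smooth f) (hg : Smooth g) (s : S1) :
    Ds (fun s => f s * g s) s = Ds f s * g s + f s * Ds g s := by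
  induction s using QuotientAddGroup.induction_on with
  | H t => exact Ds_eq_of_hasDerivAt ((hf.hasDerivAt t).mul (hg.hasDerivAt t))

theorem Ds_const_smul {f : S1 → V} (hf : Smooth f) (a : ℝ) (s : S1) :
    Ds (fun s => a • f s) s = a • Ds f s := by
  induction s using QuotientAddGroup.induction_on with
  | H t => exact Ds_eq_of_hasDerivAt ((hf.hasDerivAt t).const_smul a)

theorem Ds_inner {f g : S1 → E2} (hf : Smooth f) (hg : Smooth g) (s : S1) :
    Ds (fun s => ⟪f s, g s⟫) s = ⟪f s, Ds g s⟫ + ⟪Ds f s, g s⟫ := by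
  induction s using QuotientAddGroup.induction_on with
  | H t => exact Ds_eq_of_hasDerivAt ((hf.hasDerivAt t).inner ℝ (hg.hasDerivAt t))

end Circle

/-! ### The quarter turn and oriented orthonormal frames -/

section Rotation

theorem inner_E2 (v w : E2) : ⟪v, w⟫ = v 0 * w 0 + v 1 * w 1 := by
  simp [PiLp.inner_apply, Fin.sum_univ_two, mul_comm]

/-- The rotation by `π/2` as a continuous linear map. -/
def rotL : E2 →L[ℝ] E2 :=
  LinearMap.toContinuousLinearMap
    { toFun := rot
      map_add' := fun v w => by ext i; fin_cases i <;> simp [rot]; ring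
      map_smul' := fun c v => by ext i; fin_cases i <;> simp [rot] }

theorem rotL_apply (v : E2) : rotL v = rot v := rfl

theorem inner_rot_self (v : E2) : ⟪v, rot v⟫ = 0 := by
  rw [inner_E2]; simp [rot]; ring

theorem inner_rot_rot (v w : E2) : ⟪rot v, rot w⟫ = ⟪v, w⟫ := by
  rw [inner_E2, inner_E2]; simp [rot]; ring

theorem rot_rot (v : E2) : rot (rot v) = -v := by
  ext i; fin_cases i <;> simp [rot]

/-- Expansion of a vector in the oriented orthonormal frame of a unit vector. -/
theorem frame_expansion {v : E2} (hv : ⟪v, v⟫ = 1) (x : E2) :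
    x = ⟪x, v⟫ • v + ⟪x, rot v⟫ • rot v := by
  simp only [inner_E2] at *
  ext i; fin_cases i <;> simp [rot]
  · linear_combination (-x 0) * hv
  · linear_combination (-x 1) * hv

theorem Smooth.rot {f : S1 → E2} (hf : Smooth f) : Smooth (fun s => rot (f s)) :=
  rotL.contDiff.comp (g := rotL) (f := fun t : ℝ => f (t : S1)) hf

theorem Ds_rot {f : S1 → E2} (hf : Smooth f) (s : S1) :
    Ds (fun s => rot (f s)) s = rot (Ds f s) := by
  induction s using QuotientAddGroup.induction_on with
  | H t => exact Ds_eq_of_hasDerivAt (rotL.hasFDerivAt.comp_hasDerivAt t (hf.hasDerivAt t))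

end Rotation

/-! ### Frenet equations and the formula for the form -/

section Frame

variable (γ : MHat)

theorem inner_tangent_tangent (s : S1) : ⟪tangent γ s, tangent γ s⟫ = 1 := γ.2.2 s

theorem inner_normal_normal (s : S1) : ⟪normal γ s, normal γ s⟫ = 1 :=
  (inner_rot_rot _ _).trans (inner_tangent_tangent γ s)

theorem inner_tangent_normal (s : S1) : ⟪tangent γ s, normal γ s⟫ = 0 := inner_rot_self _

theorem inner_normal_tangent (s : S1) : ⟪normal γ s, tangent γ s⟫ = 0 := by
  rw [real_inner_comm, inner_tangent_normal]

theorem smooth_tangent : Smooth (tangent γ) := γ.2.1.ds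

theorem smooth_normal : Smooth (normal γ) := (smooth_tangent γ).rot

theorem smooth_curvature : Smooth (curvature γ) := (smooth_tangent γ).ds.inner (smooth_normal γ)

/-- Differentiating `|T|² = 1` shows that `T_s` has no tangential part. -/
theorem Ds_tangent (s : S1) : Ds (tangent γ) s = curvature γ s • normal γ s := by
  have h : ⟪Ds (tangent γ) s, tangent γ s⟫ = 0 := by
    have h1 := Ds_inner (smooth_tangent γ) (smooth_tangent γ) s
    rw [funext (inner_tangent_tangent γ), Ds_const, real_inner_comm] at h1
    linarith
  have h2 := frame_expansion (inner_tangent_tangent γ s) (Ds (tangent γ) s)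
  rwa [h, zero_smul, zero_add] at h2

theorem Ds_normal (s : S1) : Ds (normal γ) s = -(curvature γ s • tangent γ s) := by
  have h : Ds (normal γ) s = rotL (Ds (tangent γ) s) := Ds_rot (smooth_tangent γ) s
  rw [h, Ds_tangent, map_smul, rotL_apply, normal, rot_rot, smul_neg]

theorem smooth_frameField {lam mu : S1 → ℝ} (hl : Smooth lam) (hm : Smooth mu) :
    Smooth (frameField γ lam mu) :=
  (hl.smul (smooth_tangent γ)).add (hm.smul (smooth_normal γ))

theorem Ds_frameField {lam mu : S1 → ℝ} (hl : Smooth lam) (hm : Smooth mu) :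
    Ds (frameField γ lam mu) =
      frameField γ (fun s => Ds lam s - curvature γ s * mu s)
        (fun s => curvature γ s * lam s + Ds mu s) := by
  funext s
  induction s using QuotientAddGroup.induction_on with
  | H t =>
    have h := ((hl.hasDerivAt t).smul ((smooth_tangent γ).hasDerivAt t)).add
      ((hm.hasDerivAt t).smul ((smooth_normal γ).hasDerivAt t))
    refine (Ds_eq_of_hasDerivAt (f := frameField γ lam mu) h).trans ?_
    rw [Ds_tangent, Ds_normal]
    change _ = (_ : ℝ) • tangent γ (t : S1) + (_ : ℝ) • normal γ (t : S1)
    module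

theorem inner_frameField (a b c d : S1 → ℝ) (s : S1) :
    ⟪frameField γ a b s, frameField γ c d s⟫ = a s * c s + b s * d s := by
  simp only [frameField, inner_add_left, inner_add_right, real_inner_smul_left,
    real_inner_smul_right, inner_tangent_tangent, inner_normal_normal, inner_tangent_normal,
    inner_normal_tangent]
  ring

variable {γ}

/-- The condition `λ_s = κμ` is exactly the vanishing of the tangential part. -/
theorem IsTangentPair.Ds_frameField {lam mu : S1 → ℝ} (h : IsTangentPair γ lam mu) :
    Ds (frameField γ lam mu) =
      frameField γ (fun _ => 0) (fun s => curvature γ s * lam s + Ds mu s) := by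
  rw [PlaneCurves.Ds_frameField γ h.1 h.2.1]
  congr 1
  funext s
  rw [h.2.2 s, sub_self]

theorem IsTangentPair.smooth_normalRate {lam mu : S1 → ℝ} (h : IsTangentPair γ lam mu) :
    Smooth (fun s => curvature γ s * lam s + Ds mu s) :=
  ((smooth_curvature γ).mul h.1).add h.2.1.ds

/-- The product rule on `κλ` produces the nonlocal term `κ_s λ`, and `κ λ_s = κ² μ` by tangency. -/
theorem IsTangentPair.Ds_normalRate {lam mu : S1 → ℝ} (h : IsTangentPair γ lam mu) (s : S1) :
    Ds (fun s => curvature γ s * lam s + Ds mu s) s = 2 * OmegaHat γ lam mu s := by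
  rw [Ds_add ((smooth_curvature γ).mul h.1) h.2.1.ds, Ds_mul (smooth_curvature γ) h.1, h.2.2 s,
    OmegaHat]
  ring

/-- As `D_s X` is purely normal, only the normal part of `D_s² Y` contributes. -/
theorem omegaHat1_frameField {lam mu lam' mu' : S1 → ℝ} (h : IsTangentPair γ lam mu)
    (h' : IsTangentPair γ lam' mu') :
    omegaHat1 (frameField γ lam mu) (frameField γ lam' mu') =
      ∫ s : S1, (curvature γ s * lam s + Ds mu s) * OmegaHat γ lam' mu' s := by
  rw [omegaHat1, h.Ds_frameField, h'.Ds_frameField,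
    Ds_frameField γ (smooth_const 0) h'.smooth_normalRate, ← integral_const_mul]
  refine integral_congr_ae (.of_forall fun s => ?_)
  simp only [inner_frameField, h'.Ds_normalRate]
  ring

end Frame

/-! ### Invariance under translation of the parameter -/

section Action

theorem tangent_vadd (σ : S1) (γ : MHat) : tangent (σ +ᵥ γ) = shift σ (tangent γ) := Ds_shift σ γ.1

theorem normal_vadd (σ : S1) (γ : MHat) : normal (σ +ᵥ γ) = shift σ (normal γ) := by
  funext s
  simp only [normal, tangent_vadd, shift]

theorem curvature_vadd (σ : S1) (γ : MHat) : curvature (σ +ᵥ γ) = shift σ (curvature γ) := by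
  funext s
  simp only [curvature, tangent_vadd, normal_vadd, Ds_shift]
  rfl

theorem IsTangentPair.shift {γ : MHat} {lam mu : S1 → ℝ} (h : IsTangentPair γ lam mu) (σ : S1) :
    IsTangentPair (σ +ᵥ γ) (shift σ lam) (shift σ mu) := by
  refine ⟨h.1.shift σ, h.2.1.shift σ, fun s => ?_⟩
  rw [Ds_shift, curvature_vadd]
  exact h.2.2 (s + σ)

theorem shift_mem_tangentSpace {γ : MHat} {X : S1 → E2} (hX : X ∈ tangentSpace γ) (σ : S1) :
    shift σ X ∈ tangentSpace (σ +ᵥ γ) := by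
  obtain ⟨lam, mu, h, rfl⟩ := hX
  refine ⟨_, _, h.shift σ, ?_⟩
  funext s
  simp only [frameField, tangent_vadd, normal_vadd, PlaneCurves.shift]

theorem omegaHat1_shift (σ : S1) (X Y : S1 → E2) :
    omegaHat1 (shift σ X) (shift σ Y) = omegaHat1 X Y := by
  simp only [omegaHat1, Ds_shift]
  congr 1
  exact integral_add_right_eq_self (fun s => ⟪Ds X s, Ds (Ds Y) s⟫) σ

theorem HHat1_vadd (σ : S1) (γ : MHat) : HHat1 (σ +ᵥ γ) = HHat1 γ := by
  simp only [HHat1, curvature_vadd]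
  exact integral_add_right_eq_self (fun s => (1 / 4) * curvature γ s ^ 2) σ

theorem fundamentalField_eq (a : ℝ) (γ : MHat) :
    fundamentalField a γ = fun s => a • tangent γ s := by
  funext s
  induction s using QuotientAddGroup.induction_on with
  | H t =>
    have h1 : HasDerivAt (fun τ : ℝ => t + τ * a) a 0 := by
      simpa using ((hasDerivAt_id (0 : ℝ)).mul_const a).const_add t
    have h2 : HasDerivAt (fun x : ℝ => γ.1 (x : S1)) (tangent γ (t : S1)) (t + 0 * a) := by
      rw [zero_mul, add_zero]
      exact γ.2.1.hasDerivAt t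
    exact (h2.scomp (0 : ℝ) h1).deriv

theorem fundamentalField_mem_tangentSpace (a : ℝ) (γ : MHat) :
    fundamentalField a γ ∈ tangentSpace γ := by
  refine ⟨fun _ => a, fun _ => 0, ⟨smooth_const a, smooth_const 0, fun s => ?_⟩, ?_⟩
  · rw [Ds_const, mul_zero]
  · rw [fundamentalField_eq]
    funext s
    simp [frameField]

end Action

/-! ### Velocities of motions and the moment map -/

section Motion

/-- The lift of a family of curves to a map of `(t, s) ∈ ℝ × ℝ`. -/
def familyLift (Γ : ℝ → MHat) : ℝ × ℝ → E2 := fun p => (Γ p.1).1 (p.2 : S1)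

variable {Γ : ℝ → MHat}

theorem IsMotion.contDiff_familyLift (hΓ : IsMotion Γ) : ContDiff ℝ ∞ (familyLift Γ) := hΓ

theorem Ds_eq_partialSnd {V : Type} [NormedAddCommGroup V] [NormedSpace ℝ V] {G : ℝ × ℝ → V}
    (hG : ContDiff ℝ ∞ G) {f : S1 → V} {t : ℝ} (h : ∀ s : ℝ, f (s : S1) = G (t, s)) (s : ℝ) :
    Ds f (s : S1) = partialSnd G (t, s) := by
  refine Ds_eq_of_hasDerivAt ?_
  rw [funext h]
  exact hasDerivAt_partialSnd hG t s

theorem IsMotion.tangent_coe (hΓ : IsMotion Γ) (t s : ℝ) :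
    tangent (Γ t) (s : S1) = partialSnd (familyLift Γ) (t, s) :=
  Ds_eq_partialSnd hΓ.contDiff_familyLift (fun _ => rfl) s

theorem IsMotion.Ds_tangent_coe (hΓ : IsMotion Γ) (t s : ℝ) :
    Ds (tangent (Γ t)) (s : S1) = partialSnd (partialSnd (familyLift Γ)) (t, s) :=
  Ds_eq_partialSnd (contDiff_partialSnd hΓ.contDiff_familyLift) (hΓ.tangent_coe t) s

theorem IsMotion.initialVelocity_coe (hΓ : IsMotion Γ) (s : ℝ) :
    initialVelocity Γ (s : S1) = partialFst (familyLift Γ) (0, s) :=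
  (hasDerivAt_partialFst hΓ.contDiff_familyLift 0 s).deriv

theorem IsMotion.smooth_initialVelocity (hΓ : IsMotion Γ) : Smooth (initialVelocity Γ) := by
  unfold Smooth
  rw [funext hΓ.initialVelocity_coe]
  exact (contDiff_partialFst hΓ.contDiff_familyLift).comp (contDiff_const.prodMk contDiff_id)

theorem IsMotion.Ds_initialVelocity_coe (hΓ : IsMotion Γ) (s : ℝ) :
    Ds (initialVelocity Γ) (s : S1) = partialFst (partialSnd (familyLift Γ)) (0, s) := by
  rw [partialFst_partialSnd hΓ.contDiff_familyLift]
  exact Ds_eq_partialSnd (contDiff_partialFst hΓ.contDiff_familyLift) hΓ.initialVelocity_coe s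

/-- Symmetry of second derivatives moves the time derivative past both `s`-derivatives. -/
theorem IsMotion.Ds_Ds_initialVelocity_coe (hΓ : IsMotion Γ) (s : ℝ) :
    Ds (Ds (initialVelocity Γ)) (s : S1) =
      partialFst (partialSnd (partialSnd (familyLift Γ))) (0, s) := by
  have h := contDiff_partialSnd hΓ.contDiff_familyLift
  rw [partialFst_partialSnd h]
  exact Ds_eq_partialSnd (contDiff_partialFst h) hΓ.Ds_initialVelocity_coe s

theorem IsMotion.inner_Ds_initialVelocity_tangent (hΓ : IsMotion Γ) (s : S1) :
    ⟪Ds (initialVelocity Γ) s, tangent (Γ 0) s⟫ = 0 := by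
  induction s using QuotientAddGroup.induction_on with
  | H s =>
    have h := hasDerivAt_partialFst (contDiff_partialSnd hΓ.contDiff_familyLift) 0 s
    have h1 := h.inner ℝ h
    have h2 : (fun t => ⟪partialSnd (familyLift Γ) (t, s), partialSnd (familyLift Γ) (t, s)⟫)
        = fun _ => (1 : ℝ) := by
      funext t
      rw [← hΓ.tangent_coe, inner_tangent_tangent]
    rw [h2] at h1
    have h3 := h1.unique (hasDerivAt_const 0 1)
    rw [real_inner_comm, ← two_mul] at h3
    have h4 : ⟪partialFst (partialSnd (familyLift Γ)) (0, s), partialSnd (familyLift Γ) (0, s)⟫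
        = 0 := by linarith
    rw [← hΓ.Ds_initialVelocity_coe, ← hΓ.tangent_coe] at h4
    exact h4

theorem IsMotion.initialVelocity_mem_tangentSpace (hΓ : IsMotion Γ) :
    initialVelocity Γ ∈ tangentSpace (Γ 0) := by
  have hY := hΓ.smooth_initialVelocity
  refine ⟨fun s => ⟪initialVelocity Γ s, tangent (Γ 0) s⟫,
    fun s => ⟪initialVelocity Γ s, normal (Γ 0) s⟫,
    ⟨hY.inner (smooth_tangent _), hY.inner (smooth_normal _), fun s => ?_⟩, ?_⟩
  · rw [Ds_inner hY (smooth_tangent _), hΓ.inner_Ds_initialVelocity_tangent, Ds_tangent,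
      real_inner_smul_right, add_zero]
  · funext s
    exact frame_expansion (inner_tangent_tangent _ s) _

/-- Writing `κ²` as `|T_s|²` removes the normal, so only `γ_ss` has to be differentiated in time. -/
theorem HHat1_eq_intervalIntegral (δ : MHat) :
    HHat1 δ = ∫ s in (0 : ℝ)..(2 * Real.pi),
      (1 / 4) * ⟪Ds (tangent δ) (s : S1), Ds (tangent δ) (s : S1)⟫ := by
  have h := AddCircle.intervalIntegral_preimage (2 * Real.pi) 0
    (fun s : S1 => (1 / 4) * curvature δ s ^ 2)
  rw [zero_add] at h
  rw [HHat1, ← h]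
  refine intervalIntegral.integral_congr fun s _ => ?_
  simp only [Ds_tangent, real_inner_smul_left, real_inner_smul_right, inner_normal_normal]
  ring

theorem IsMotion.hasDerivAt_HHat1 (hΓ : IsMotion Γ) :
    HasDerivAt (fun t => HHat1 (Γ t)) (omegaHat1 (tangent (Γ 0)) (initialVelocity Γ)) 0 := by
  have hG : ContDiff ℝ ∞ (partialSnd (partialSnd (familyLift Γ))) :=
    contDiff_partialSnd (contDiff_partialSnd hΓ.contDiff_familyLift)
  have hf : ContDiff ℝ ∞ fun p => (1 / 4 : ℝ) * ⟪partialSnd (partialSnd (familyLift Γ)) p,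
      partialSnd (partialSnd (familyLift Γ)) p⟫ := contDiff_const.mul (hG.inner ℝ hG)
  have h := hasDerivAt_intervalIntegral_param hf 0 (2 * Real.pi) 0
  have hH : (fun t => HHat1 (Γ t)) = fun t => ∫ s in (0 : ℝ)..(2 * Real.pi),
      (1 / 4 : ℝ) * ⟪partialSnd (partialSnd (familyLift Γ)) (t, s),
        partialSnd (partialSnd (familyLift Γ)) (t, s)⟫ := by
    funext t
    simp only [HHat1_eq_intervalIntegral, hΓ.Ds_tangent_coe]
  rw [hH]
  refine h.congr_deriv ?_
  have h' := AddCircle.intervalIntegral_preimage (2 * Real.pi) 0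
    (fun s : S1 => ⟪Ds (tangent (Γ 0)) s, Ds (Ds (initialVelocity Γ)) s⟫)
  rw [zero_add] at h'
  rw [omegaHat1, ← h', ← intervalIntegral.integral_const_mul]
  refine intervalIntegral.integral_congr fun s _ => ?_
  have hd := hasDerivAt_partialFst hG 0 s
  rw [← ((hd.inner ℝ hd).const_mul (1 / 4)).unique (hasDerivAt_partialFst hf 0 s)]
  simp only [hΓ.Ds_tangent_coe, hΓ.Ds_Ds_initialVelocity_coe]
  rw [real_inner_comm (partialSnd (partialSnd (familyLift Γ)) (0, s))]
  ring

theorem omegaHat1_const_smul_left (a : ℝ) {X : S1 → E2} (hX : Smooth X) (Y : S1 → E2) :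
    omegaHat1 (fun s => a • X s) Y = omegaHat1 X Y * a := by
  simp only [omegaHat1, Ds_const_smul hX, real_inner_smul_left, integral_const_mul]
  ring

/-- The moment map of the rotation action, `∂/∂σ ↦ Ĥ₁`. -/
def momentMap (γ : MHat) : Module.Dual ℝ ℝ := HHat1 γ • LinearMap.id

theorem isMomentMap_momentMap : IsMomentMap omegaHat1 momentMap where
  differential := by
    rintro a γ Y - Γ hΓ rfl rfl
    refine (hΓ.hasDerivAt_HHat1.mul_const a).congr_deriv ?_
    rw [← omegaHat1_const_smul_left a (smooth_tangent _), ← fundamentalField_eq]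
  equivariant σ γ := by rw [momentMap, momentMap, HHat1_vadd]

end Motion

/-! ### Construction of a motion with prescribed velocity -/

section Construction

open Topology Filter

theorem Smooth.integral_Ds {V : Type} [NormedAddCommGroup V] [NormedSpace ℝ V] [CompleteSpace V]
    {f : S1 → V} (hf : Smooth f) (a b : ℝ) :
    ∫ s in a..b, Ds f (s : S1) = f (b : S1) - f (a : S1) :=
  intervalIntegral.integral_eq_sub_of_hasDerivAt (fun t _ => hf.hasDerivAt t)
    ((ContDiff.continuous hf.ds).intervalIntegrable _ _)

theorem Smooth.integral_Ds_period {V : Type} [NormedAddCommGroup V] [NormedSpace ℝ V]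
    [CompleteSpace V] {f : S1 → V} (hf : Smooth f) :
    ∫ s in (0 : ℝ)..(2 * Real.pi), Ds f (s : S1) = 0 := by
  rw [hf.integral_Ds, AddCircle.coe_period, AddCircle.coe_zero, sub_self]

theorem contDiff_integral_zero_to {V : Type} [NormedAddCommGroup V] [NormedSpace ℝ V]
    {H : ℝ × ℝ → V} (hH : ContDiff ℝ ∞ H) :
    ContDiff ℝ ∞ (fun p : ℝ × ℝ => ∫ x in (0 : ℝ)..p.2, H (p.1, x)) := by
  -- Rescaling to the fixed interval `[0, 1]` moves the variable endpoint into the integrand.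
  have h1 : (fun p : ℝ × ℝ => ∫ x in (0 : ℝ)..p.2, H (p.1, x))
      = fun p : ℝ × ℝ => p.2 • ∫ x in (0 : ℝ)..1, H (p.1, x * p.2) := by
    funext p
    rw [intervalIntegral.smul_integral_comp_mul_right (fun x => H (p.1, x)), zero_mul, one_mul]
  rw [h1]
  refine contDiff_snd.smul (contDiff_intervalIntegral_param
    (f := fun q : (ℝ × ℝ) × ℝ => H (q.1.1, q.2 * q.1.2)) ?_ 0 1)
  exact hH.comp (by fun_prop)

/-- A smooth family of closed unit-length tangents integrates to a motion, and the initial velocity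
can be prescribed up to the base point by that of the tangents. -/
theorem exists_motion_of_tangents (γ : MHat) {Y : S1 → E2} (hY : Smooth Y) {H : ℝ × ℝ → E2}
    (hH : ContDiff ℝ ∞ H) (hper : ∀ t, Function.Periodic (fun s => H (t, s)) (2 * Real.pi))
    (hunit : ∀ p, ⟪H p, H p⟫ = 1) (hclosed : ∀ t, ∫ s in (0 : ℝ)..(2 * Real.pi), H (t, s) = 0)
    (h0 : ∀ s : ℝ, H (0, s) = tangent γ (s : S1))
    (h0' : ∀ s : ℝ, HasDerivAt (fun t => H (t, s)) (Ds Y (s : S1)) 0) :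
    ∃ Γ : ℝ → MHat, IsMotion Γ ∧ Γ 0 = γ ∧ initialVelocity Γ = Y := by
  -- The integration constant gives the base point the position `γ(0)` and velocity `Y(0)`, which
  -- the tangents do not determine.
  set G : ℝ × ℝ → E2 := fun p => γ.1 0 + p.1 • Y 0 + ∫ x in (0 : ℝ)..p.2, H (p.1, x) with hGdef
  have hG : ContDiff ℝ ∞ G :=
    (contDiff_const.add (contDiff_fst.smul contDiff_const)).add (contDiff_integral_zero_to hH)
  have hHc : ∀ t, Continuous fun s => H (t, s) := fun t => hH.continuous.comp (by fun_prop)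
  have hGper : ∀ t, Function.Periodic (fun s => G (t, s)) (2 * Real.pi) := by
    intro t s
    have h := (hper t).intervalIntegral_add_eq s 0
    rw [zero_add, hclosed] at h
    have h2 := intervalIntegral.integral_add_adjacent_intervals
      ((hHc t).intervalIntegrable (μ := volume) 0 s)
      ((hHc t).intervalIntegrable s (s + 2 * Real.pi))
    rw [h, add_zero] at h2
    simp only [hGdef, h2]
  have hGs : ∀ t s, HasDerivAt (fun s => G (t, s)) (H (t, s)) s := fun t s =>
    (intervalIntegral.integral_hasDerivAt_right ((hHc t).intervalIntegrable _ _)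
      ((hHc t).stronglyMeasurableAtFilter _ _) (hHc t).continuousAt).const_add (γ.1 0 + t • Y 0)
  let g : ℝ → S1 → E2 := fun t => (hGper t).lift
  have hg : ∀ t (s : ℝ), g t (s : S1) = G (t, s) := fun t s => (hGper t).lift_coe s
  have hmem : ∀ t, g t ∈ MHat := by
    refine fun t => ⟨?_, fun s => ?_⟩
    · unfold Smooth
      rw [funext (hg t)]
      exact hG.comp (contDiff_const.prodMk contDiff_id)
    · induction s using QuotientAddGroup.induction_on with
      | H s =>
        have h : Ds (g t) (s : S1) = H (t, s) := Ds_eq_of_hasDerivAt (by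
          rw [funext (hg t)]; exact hGs t s)
        exact h ▸ hunit _
  refine ⟨fun t => ⟨g t, hmem t⟩, ?_, ?_, ?_⟩
  · unfold IsMotion
    simpa only [hg] using hG
  · refine Subtype.ext (funext fun s => ?_)
    induction s using QuotientAddGroup.induction_on with
    | H s =>
      have h : ∫ x in (0 : ℝ)..s, H (0, x) = γ.1 (s : S1) - γ.1 ((0 : ℝ) : S1) := by
        simp only [h0]
        exact γ.2.1.integral_Ds 0 s
      refine (hg 0 s).trans ?_
      simp only [hGdef, h, AddCircle.coe_zero]
      simp
  · funext s
    induction s using QuotientAddGroup.induction_on with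
    | H s =>
      have h1 := hasDerivAt_intervalIntegral_param hH 0 s 0
      have h2 : ∫ x in (0 : ℝ)..s, partialFst H (0, x) = Y (s : S1) - Y 0 := by
        simp only [fun x => (hasDerivAt_partialFst hH 0 x).unique (h0' x)]
        exact hY.integral_Ds 0 s
      rw [h2] at h1
      have h3 : HasDerivAt (fun t => G (t, s)) (Y (s : S1)) 0 := by
        refine ((((hasDerivAt_id (0 : ℝ)).smul_const (Y 0)).const_add (γ.1 0)).add h1).congr_deriv ?_
        module
      change deriv (fun t => g t (s : S1)) 0 = _
      rw [funext fun t => hg t s]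
      exact h3.deriv

variable (γ : MHat) (ψ : S1 → ℝ)

/-- The angle `τ ψ + ⟨w, N⟩` by which the tangent at `s` is turned, for `p = ((τ, w), s)`. -/
def turnAngle (p : (ℝ × E2) × ℝ) : ℝ :=
  p.1.1 * ψ (p.2 : S1) + ⟪p.1.2, normal γ (p.2 : S1)⟫

/-- The tangent of `γ` turned by the angle `τ ψ + ⟨w, N⟩`. -/
def turnedTangent (p : (ℝ × E2) × ℝ) : E2 :=
  Real.cos (turnAngle γ ψ p) • tangent γ (p.2 : S1) +
    Real.sin (turnAngle γ ψ p) • normal γ (p.2 : S1)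

/-- The closing defect of the turned tangents. -/
def closingDefect (q : ℝ × E2) : E2 := ∫ s in (0 : ℝ)..(2 * Real.pi), turnedTangent γ ψ (q, s)

theorem inner_turnedTangent_self (p : (ℝ × E2) × ℝ) :
    ⟪turnedTangent γ ψ p, turnedTangent γ ψ p⟫ = 1 := by
  have h := inner_frameField γ (fun _ => Real.cos (turnAngle γ ψ p))
    (fun _ => Real.sin (turnAngle γ ψ p)) (fun _ => Real.cos (turnAngle γ ψ p))
    (fun _ => Real.sin (turnAngle γ ψ p)) (p.2 : S1)
  refine h.trans ?_
  rw [← sq, ← sq, Real.cos_sq_add_sin_sq]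

theorem turnedTangent_periodic (q : ℝ × E2) :
    Function.Periodic (fun s => turnedTangent γ ψ (q, s)) (2 * Real.pi) := by
  intro s
  simp only [turnedTangent, turnAngle, AddCircle.coe_add_period]

theorem turnedTangent_zero (s : ℝ) : turnedTangent γ ψ ((0, 0), s) = tangent γ (s : S1) := by
  simp [turnedTangent, turnAngle]

theorem closingDefect_zero : closingDefect γ ψ (0, 0) = 0 := by
  simp only [closingDefect, turnedTangent_zero]
  exact γ.2.1.integral_Ds_period

variable {ψ}

theorem contDiff_turnedTangent (hψ : Smooth ψ) : ContDiff ℝ ∞ (turnedTangent γ ψ) := by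
  have hT : ContDiff ℝ ∞ fun p : (ℝ × E2) × ℝ => tangent γ (p.2 : S1) :=
    ContDiff.comp (g := fun t : ℝ => tangent γ (t : S1)) (smooth_tangent γ) contDiff_snd
  have hN : ContDiff ℝ ∞ fun p : (ℝ × E2) × ℝ => normal γ (p.2 : S1) :=
    ContDiff.comp (g := fun t : ℝ => normal γ (t : S1)) (smooth_normal γ) contDiff_snd
  have hψ' : ContDiff ℝ ∞ fun p : (ℝ × E2) × ℝ => ψ (p.2 : S1) :=
    ContDiff.comp (g := fun t : ℝ => ψ (t : S1)) hψ contDiff_snd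
  have hα : ContDiff ℝ ∞ (turnAngle γ ψ) :=
    (contDiff_fst.fst.mul hψ').add (contDiff_fst.snd.inner ℝ hN)
  exact (hα.cos.smul hT).add (hα.sin.smul hN)

theorem contDiff_closingDefect (hψ : Smooth ψ) : ContDiff ℝ ∞ (closingDefect γ ψ) :=
  contDiff_intervalIntegral_param (contDiff_turnedTangent γ hψ) _ _

/-- The first variation of the turned tangents along a curve of parameters through the origin. -/
theorem hasDerivAt_turnedTangent {q : ℝ → ℝ × E2} {v : ℝ × E2} (hq : HasDerivAt q v 0)
    (hq0 : q 0 = (0, 0)) (s : ℝ) :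
    HasDerivAt (fun t => turnedTangent γ ψ (q t, s))
      (turnAngle γ ψ (v, s) • normal γ (s : S1)) 0 := by
  have hα : HasDerivAt (fun t => turnAngle γ ψ (q t, s)) (turnAngle γ ψ (v, s)) 0 := by
    have h1 : HasDerivAt (fun t => (q t).1) v.1 0 := hq.fst
    have h2 : HasDerivAt (fun t => (q t).2) v.2 0 := hq.snd
    refine ((h1.mul_const (ψ (s : S1))).add
      (h2.inner ℝ (hasDerivAt_const 0 (normal γ (s : S1))))).congr_deriv ?_
    simp [turnAngle]
  refine ((hα.cos.smul_const (tangent γ (s : S1))).add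
    (hα.sin.smul_const (normal γ (s : S1)))).congr_deriv ?_
  have h0 : turnAngle γ ψ (q 0, s) = 0 := by simp [turnAngle, hq0]
  simp [h0]

/-- To first order, turning `T` by a small angle `α` adds `αN`; the derivative is computed along the
line `t • v`. -/
theorem fderiv_closingDefect (hψ : Smooth ψ) (v : ℝ × E2) :
    fderiv ℝ (closingDefect γ ψ) (0, 0) v =
      ∫ s in (0 : ℝ)..(2 * Real.pi), turnAngle γ ψ (v, s) • normal γ (s : S1) := by
  have hf := contDiff_turnedTangent γ hψ
  have hline : HasDerivAt (fun t : ℝ => t • v) v 0 := by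
    simpa using (hasDerivAt_id (0 : ℝ)).smul_const v
  have h1 : HasDerivAt (fun t : ℝ => closingDefect γ ψ (t • v))
      (fderiv ℝ (closingDefect γ ψ) (0, 0) v) 0 := by
    have h := ((contDiff_closingDefect γ hψ).differentiable (by simp)).differentiableAt.hasFDerivAt
      (x := (0 : ℝ) • v)
    have h' := h.comp_hasDerivAt 0 hline
    rw [zero_smul] at h'
    exact h'
  have hg : ContDiff ℝ ∞ fun p : ℝ × ℝ => turnedTangent γ ψ (p.1 • v, p.2) :=
    hf.comp (by fun_prop)
  rw [h1.unique (hasDerivAt_intervalIntegral_param hg 0 (2 * Real.pi) 0)]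
  refine intervalIntegral.integral_congr fun s _ => ?_
  exact (hasDerivAt_partialFst hg 0 s).unique
    (hasDerivAt_turnedTangent γ hline (zero_smul ℝ v) s)

/-- By Rolle, the periodic height function `⟨w, γ⟩` has a critical point; there `w` is orthogonal to
`T` as well as to `N`. -/
theorem eq_zero_of_inner_normal_eq_zero {w : E2} (hw : ∀ s : ℝ, ⟪w, normal γ (s : S1)⟫ = 0) :
    w = 0 := by
  have hd : ∀ s : ℝ, HasDerivAt (fun t : ℝ => ⟪w, γ.1 (t : S1)⟫) ⟪w, tangent γ (s : S1)⟫ s := by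
    intro s
    refine ((hasDerivAt_const s w).inner ℝ (γ.2.1.hasDerivAt s)).congr_deriv ?_
    rw [inner_zero_left, add_zero]
    rfl
  obtain ⟨c, -, hc⟩ := exists_hasDerivAt_eq_zero (f := fun t : ℝ => ⟪w, γ.1 (t : S1)⟫)
    Real.two_pi_pos (fun s _ => (hd s).continuousAt.continuousWithinAt)
    (by simp only [AddCircle.coe_period, AddCircle.coe_zero]) (fun s _ => hd s)
  have h := frame_expansion (inner_tangent_tangent γ (c : S1)) w
  have hn : ⟪w, rot (tangent γ (c : S1))⟫ = 0 := hw c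
  rwa [hc, hn, zero_smul, zero_smul, add_zero] at h

/-- Pairing `∫ ⟨w, N⟩ N = 0` with `w` gives `∫ ⟨w, N⟩² = 0`, so the continuous integrand vanishes.
-/
theorem fderiv_closingDefect_inr_injective (hψ : Smooth ψ) :
    Function.Injective (fderiv ℝ (closingDefect γ ψ) (0, 0) ∘L .inr ℝ ℝ E2) := by
  refine (injective_iff_map_eq_zero _).2 fun w hw => eq_zero_of_inner_normal_eq_zero γ ?_
  have hN : Continuous fun s : ℝ => normal γ (s : S1) := ContDiff.continuous (smooth_normal γ)
  have hc : Continuous fun s : ℝ => ⟪w, normal γ (s : S1)⟫ := continuous_const.inner hN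
  have hw' : ∫ s in (0 : ℝ)..(2 * Real.pi), ⟪w, normal γ (s : S1)⟫ • normal γ (s : S1) = 0 := by
    have h := fderiv_closingDefect γ hψ (0, w)
    simp only [turnAngle, zero_mul, zero_add] at h
    exact h.symm.trans hw
  have hsq : ∫ s in (0 : ℝ)..(2 * Real.pi), ⟪w, normal γ (s : S1)⟫ ^ 2 = 0 := by
    have h := (innerSL ℝ w).intervalIntegral_comp_comm
      ((hc.smul hN).intervalIntegrable (μ := volume) 0 (2 * Real.pi))
    refine Eq.trans ?_ (h.trans ((congrArg (innerSL ℝ w) hw').trans (map_zero _)))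
    refine intervalIntegral.integral_congr fun s _ => ?_
    simp [sq]
  intro s
  by_contra hs
  have hper : Function.Periodic (fun s : ℝ => ⟪w, normal γ (s : S1)⟫ ^ 2) (2 * Real.pi) :=
    fun s => by simp only [AddCircle.coe_add_period]
  -- The period is shifted to start at `s`, so that the arbitrary real `s` lies in the interval of
  -- integration.
  have h := hper.intervalIntegral_add_eq s 0
  rw [zero_add, hsq] at h
  exact (intervalIntegral.integral_pos (by linarith [Real.two_pi_pos]) (hc.pow 2).continuousOn
    (fun _ _ => sq_nonneg _) ⟨s, ⟨le_rfl, by linarith [Real.two_pi_pos]⟩, sq_pos_of_ne_zero hs⟩).ne' h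

theorem fderiv_closingDefect_inr_isInvertible (hψ : Smooth ψ) :
    (fderiv ℝ (closingDefect γ ψ) (0, 0) ∘L .inr ℝ ℝ E2).IsInvertible := by
  have hinj := fderiv_closingDefect_inr_injective γ hψ
  exact ⟨(LinearEquiv.ofInjectiveEndo
    (fderiv ℝ (closingDefect γ ψ) (0, 0) ∘L .inr ℝ ℝ E2).toLinearMap hinj).toContinuousLinearEquiv,
    by ext; rfl⟩

/-- A deformation rate of the tangents which preserves closedness to first order is the first-order
part of a smooth family of corrected rates which preserves closedness. -/
theorem exists_closing_parameters (hψ : Smooth ψ)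
    (hclosed : ∫ s in (0 : ℝ)..(2 * Real.pi), ψ (s : S1) • normal γ (s : S1) = 0) :
    ∃ q : ℝ → ℝ × E2, ContDiff ℝ ∞ q ∧ q 0 = (0, 0) ∧ HasDerivAt q (1, 0) 0 ∧
      ∀ t, closingDefect γ ψ (q t) = 0 := by
  obtain ⟨g, hg0, hg', hg⟩ := exists_smooth_implicitFunction (contDiff_closingDefect γ hψ) (0, 0)
    (fderiv_closingDefect_inr_isInvertible γ hψ)
  -- First-order closedness kills the `τ`-derivative of the defect, so `g` has zero derivative at
  -- `0`.
  have hinl : fderiv ℝ (closingDefect γ ψ) (0, 0) ∘L .inl ℝ ℝ E2 = 0 := by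
    ext1
    have h := fderiv_closingDefect γ hψ (1, 0)
    simp only [turnAngle, one_mul, inner_zero_left, add_zero, hclosed] at h
    exact h
  rw [hinl, ContinuousLinearMap.comp_zero] at hg'
  obtain ⟨ε, hε, hball⟩ := Metric.eventually_nhds_iff.1 hg
  set δ := ε / 2 with hδ
  have hδ0 : δ ≠ 0 := by positivity
  -- This time change has `h 0 = 0`, slope `1` at `0` and `|h| ≤ ε / 2`, so the local solution `g`
  -- serves for all `t`.
  set h : ℝ → ℝ := fun t => δ * Real.sin (t / δ) with hh
  have hh0 : h 0 = 0 := by simp [hh]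
  have hh' : HasDerivAt h 1 0 := by
    refine ((((hasDerivAt_id (0 : ℝ)).div_const δ).sin).const_mul δ).congr_deriv ?_
    simp [hδ0]
  have hhs : ContDiff ℝ ∞ h := contDiff_const.mul (contDiff_id.div_const δ).sin
  have hlt : ∀ t, dist (h t) 0 < ε := by
    intro t
    rw [dist_zero_right, Real.norm_eq_abs, hh, abs_mul, abs_of_pos (by positivity : 0 < δ)]
    have := mul_le_mul_of_nonneg_left (Real.abs_sin_le_one (t / δ)) (by positivity : 0 ≤ δ)
    linarith
  refine ⟨fun t => (h t, g (h t)), ?_, ?_, ?_, fun t => ?_⟩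
  · exact hhs.prodMk (contDiff_iff_contDiffAt.2 fun t =>
      (hball (hlt t)).2.comp t hhs.contDiffAt)
  · exact Prod.ext hh0 ((congrArg g hh0).trans hg0)
  · have hg'' : HasFDerivAt g (0 : ℝ →L[ℝ] E2) (h 0) := by
      rw [hh0]
      simpa using hg'
    exact hh'.prodMk (hg''.comp_hasDerivAt 0 hh')
  · exact (hball (hlt t)).1.trans (closingDefect_zero γ ψ)

/-- The turning rate is the normal component of `D_s Y`; it meets the first-order closing condition
because `Y` is periodic. -/
theorem exists_motion_of_mem_tangentSpace {γ : MHat} {Y : S1 → E2} (hY : Y ∈ tangentSpace γ) :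
    ∃ Γ : ℝ → MHat, IsMotion Γ ∧ Γ 0 = γ ∧ initialVelocity Γ = Y := by
  obtain ⟨lam, mu, h, rfl⟩ := hY
  have hYs := smooth_frameField γ h.1 h.2.1
  have hDs : ∀ s, Ds (frameField γ lam mu) s =
      (curvature γ s * lam s + Ds mu s) • normal γ s := by
    intro s
    rw [h.Ds_frameField]
    simp [frameField]
  have hclosed := hYs.integral_Ds_period
  simp only [hDs] at hclosed
  obtain ⟨q, hq, hq0, hq', hqc⟩ := exists_closing_parameters γ h.smooth_normalRate hclosed
  refine exists_motion_of_tangents γ hYs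
    (H := fun p => turnedTangent γ (fun s => curvature γ s * lam s + Ds mu s) (q p.1, p.2))
    ((contDiff_turnedTangent γ h.smooth_normalRate).comp
      ((hq.comp contDiff_fst).prodMk contDiff_snd))
    (fun t => turnedTangent_periodic γ _ (q t)) (fun _ => inner_turnedTangent_self γ _ _) hqc
    (fun s => ?_) (fun s => ?_)
  · simp only [hq0, turnedTangent_zero]
  · refine (hasDerivAt_turnedTangent γ hq' hq0 s).congr_deriv ?_
    rw [hDs]
    simp [turnAngle]

end Construction

end

end PlaneCurves

open PlaneCurves in
theorem theorem4p3 :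
    -- the tangent space consists exactly of the velocities of smooth motions
    (∀ γ : MHat, tangentSpace γ =
      {Y | ∃ Γ : ℝ → MHat, IsMotion Γ ∧ Γ 0 = γ ∧ initialVelocity Γ = Y}) ∧
    -- the expression of the form through the recursion operator
    (∀ (γ : MHat) (lam mu lam' mu' : S1 → ℝ),
      IsTangentPair γ lam mu → IsTangentPair γ lam' mu' →
        omegaHat1 (frameField γ lam mu) (frameField γ lam' mu') =
          ∫ s : S1, (curvature γ s * lam s + Ds mu s) * OmegaHat γ lam' mu' s) ∧
    -- the action preserves the form
    (∀ (σ : S1) (γ : MHat), ∀ X ∈ tangentSpace γ, ∀ Y ∈ tangentSpace γ,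
      shift σ X ∈ tangentSpace (σ +ᵥ γ) ∧ shift σ Y ∈ tangentSpace (σ +ᵥ γ) ∧
        omegaHat1 (shift σ X) (shift σ Y) = omegaHat1 X Y) ∧
    -- the fundamental vector fields are tangent, and the moment map is given by `HHat1`
    (∀ (a : ℝ) (γ : MHat), fundamentalField a γ ∈ tangentSpace γ) ∧
    ∃ μ : MHat → Module.Dual ℝ ℝ, IsMomentMap omegaHat1 μ ∧ ∀ γ : MHat, μ γ 1 = HHat1 γ := by
  refine ⟨fun γ => ?_, fun γ lam mu lam' mu' h h' => omegaHat1_frameField h h',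
    fun σ γ X hX Y hY => ⟨shift_mem_tangentSpace hX σ, shift_mem_tangentSpace hY σ,
      omegaHat1_shift σ X Y⟩,
    fundamentalField_mem_tangentSpace, momentMap, isMomentMap_momentMap,
    fun γ => by simp [momentMap]⟩
  refine Set.Subset.antisymm (fun Y hY => exists_motion_of_mem_tangentSpace hY) ?_
  rintro Y ⟨Γ, hΓ, rfl, rfl⟩
  exact hΓ.initialVelocity_mem_tangentSpace
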